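/- Let $m,\mathrm g,l,I_1,I_2,I_3>0$ and write $\bar I_i = I_i+ml^2$ for $i=1,2$. The reduced equations of motion of the pendulum skate (mass $m$, gravitational acceleration $\mathrm g$, distance $l$ from the blade–ice contact point to the center of mass, principal moments of inertia $I_1,I_2,I_3$), in the variables $\zeta=(v^1,v^2,v^3,\Gamma_2,\Gamma_3)\in\mathbb R^5$, are $\dot\zeta=f(\zeta)$ with $$f(\zeta)=\left(\frac{\bigl((\bar I_2-I_3)\Gamma_3(v^2)^2+m\mathrm g l\bigr)\Gamma_2+ml\,\Gamma_3v^2v^3}{\bar I_1},\ \frac{2(I_3-I_2)\Gamma_2\Gamma_3v^1v^2}{I_2\Gamma_2^2+I_3\Gamma_3^2},\ -\frac{2lI_3\Gamma_3v^1v^2}{I_2\Gamma_2^2+I_3\Gamma_3^2},\ v^1\Gamma_3,\ -v^1\Gamma_2\right).$$ Physical states satisfy in addition $\Gamma_2^2+\Gamma_3^2=1$. For every $\Omega_0\in\mathbb R$ the point $\zeta_{\rm sp}=(0,\Omega_0,0,0,1)$ is an equilibrium, $f(\zeta_{\rm sp})=0$ (upright spinning). Suppose that $I_3<I_2$. (i)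 If $I_3+ml^2<I_2$, then $\zeta_{\rm sp}$ is unstable: there is $\varepsilon>0$ such that arbitrarily close to $\zeta_{\rm sp}$ there start solutions of $\dot\zeta=f(\zeta)$ that reach a distance at least $\varepsilon$ from $\zeta_{\rm sp}$ in finite time. (ii) If $I_3+ml^2>I_2$ and $|\Omega_0|>\sqrt{\dfrac{m\mathrm g l}{I_3+ml^2-I_2}}$, then $\zeta_{\rm sp}$ is Lyapunov stable: for every $\varepsilon>0$ there is $\delta>0$ such that every solution starting at distance less than $\delta$ from $\zeta_{\rm sp}$ exists for all $t\ge 0$ and stays at distance less than $\varepsilon$ from $\zeta_{\rm sp}$. Both assertions hold for the system on $\mathbb R^5$ (initial values arbitrary near $\zeta_{\rm sp}$) and also when only initial values with $\Gamma_2^2+\Gamma_3^2=1$ are allowed. -/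

import Mathlib

/-- The phase space of the reduced pendulum skate. A point is
`ζ = (v¹, v², v³, Γ₂, Γ₃)`, where `v¹ = Ω₁`, `v² = Ω ⬝ Γ` and `v³ = Y₁` are the quasivelocities
and `Γ = (0, Γ₂, Γ₃)` is the vertical direction seen from the body frame. (The norm is the
sup norm; Lyapunov stability on `ℝ⁵` does not depend on the choice of a norm.) -/
abbrev SkateState : Type := Fin 5 → ℝ

/-- The vector field `f` of the reduced equations of motion `ζ' = f(ζ)` of the pendulum skate of
mass `m`, gravitational acceleration `g`, distance `l` from the blade-ice contact point to the
center of mass, and principal moments of inertia `I₁, I₂, I₃`. -/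
noncomputable def skateField (m g l I₁ I₂ I₃ : ℝ) (ζ : SkateState) : SkateState :=
  let v₁ := ζ 0
  let v₂ := ζ 1
  let v₃ := ζ 2
  let Γ₂ := ζ 3
  let Γ₃ := ζ 4
  ![((((I₂ + m * l ^ 2) - I₃) * Γ₃ * v₂ ^ 2 + m * g * l) * Γ₂ + m * l * Γ₃ * v₂ * v₃)
      / (I₁ + m * l ^ 2),
    (2 * (I₃ - I₂) * Γ₂ * Γ₃ * v₁ * v₂) / (I₂ * Γ₂ ^ 2 + I₃ * Γ₃ ^ 2),
    -((2 * l * I₃ * Γ₃ * v₁ * v₂) / (I₂ * Γ₂ ^ 2 + I₃ * Γ₃ ^ 2)),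
    v₁ * Γ₃,
    -(v₁ * Γ₂)]

/-- The states in which `Γ = (0, Γ₂, Γ₃)` is a unit vector. -/
def unitStates : Set SkateState := {ζ | ζ 3 ^ 2 + ζ 4 ^ 2 = 1}

/-- The upright spinning state `(0, Ω₀, 0, 0, 1)`. -/
def spinningState (Ω₀ : ℝ) : SkateState := ![0, Ω₀, 0, 0, 1]

/-- `x` solves the initial value problem `x' = f(x)`, `x(0) = y` on the time interval `[0, T]`. -/
def SolvesOn {E : Type*} [NormedAddCommGroup E] [NormedSpace ℝ E]
    (f : E → E) (T : ℝ) (y : E) (x : ℝ → E) : Prop :=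
  x 0 = y ∧ ∀ t ∈ Set.Icc 0 T, HasDerivWithinAt x (f (x t)) (Set.Icc 0 T) t

/-- Lyapunov stability of `p` for `x' = f(x)` with initial values in `S`: for every `ε > 0` there
is `δ > 0` such that from every initial value in `S` at distance less than `δ` from `p` solutions
exist on every interval `[0, T]`, and all of them stay at distance less than `ε` from `p`. -/
def LyapunovStableOn {E : Type*} [NormedAddCommGroup E] [NormedSpace ℝ E]
    (f : E → E) (S : Set E) (p : E) : Prop :=
  ∀ ε > 0, ∃ δ > 0, ∀ y ∈ S, dist y p < δ → ∀ T ≥ 0,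
    (∃ x, SolvesOn f T y x) ∧
      ∀ x, SolvesOn f T y x → ∀ t ∈ Set.Icc 0 T, dist (x t) p < ε

/-- Instability of `p` for `x' = f(x)` with initial values in `S`: for some `ε > 0` there are
solutions that start in `S` arbitrarily close to `p` and reach a distance of at least `ε` from `p`
in finite time. -/
def LyapunovUnstableOn {E : Type*} [NormedAddCommGroup E] [NormedSpace ℝ E]
    (f : E → E) (S : Set E) (p : E) : Prop :=
  ∃ ε > 0, ∀ δ > 0, ∃ y ∈ S, dist y p < δ ∧ ∃ T ≥ 0, ∃ x, SolvesOn f T y x ∧ ε ≤ dist (x T) p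

theorem LyapunovUnstableOn.not_stable {E : Type*} [NormedAddCommGroup E] [NormedSpace ℝ E]
    {f : E → E} {S : Set E} {p : E} (h : LyapunovUnstableOn f S p) :
    ¬ LyapunovStableOn f S p := by
  intro hs
  obtain ⟨ε, hε, h⟩ := h
  obtain ⟨δ, hδ, hs⟩ := hs ε hε
  obtain ⟨y, hy, hyp, T, hT, x, hx, hxT⟩ := h δ hδ
  exact absurd ((hs y hy hyp T hT).2 x hx T ⟨hT, le_rfl⟩) (not_lt.mpr hxT)

/-!
For `Γ` of length different from zero the reduced pendulum skate is integrable. Write `D` for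
`I₂ Γ₂² + I₃ Γ₃²`. Four functions are constant along solutions: the length of `Γ`, the angular
momentum `D v²` about the vertical, a nonholonomic first integral (`skateGlideIntegral`) that expresses
`v³` through the tilt `Γ₂`, and the energy. On the common level set through the upright spinning
state of the first three, the energy becomes the kinetic energy of the tilting motion plus a potential
of the tilt (`skateEnergy_reduced`), whose second derivative at the upright state has the sign of
`Ω₀² (I₃ + m l² - I₂) - m g l`. This potential contains `arctan`; elementary two-sided bounds
(`skateAngle_sq_bounds`) replace its Taylor expansion.

Stability: for fast spinning the potential has a strict minimum at the upright state, which is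
therefore isolated in the level set of all four integrals
(`eventually_eq_spinningState_of_skateIntegrals_eq`). A point isolated in its level set of a
continuous conserved quantity is Lyapunov stable (`lyapunovStableOn_univ_of_conserved`). Since the
perturbed values of the integrals are covered by continuity, no reduction to unit `Γ` is needed.

Instability: if `I₃ + m l² < I₂`, the potential has a maximum at the upright state for every `Ω₀`. A
solution that starts upright with a small tilting velocity `s` stays on the level set above, so that
energy conservation keeps its tilting velocity at least `s` as long as it is near the upright state
(`sq_le_sq_of_skateIntegrals_eq`), and it leaves a fixed ball in time of order `1 / s`
(`SolvesOn.mul_le_tilt`).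

In both parts existence comes from `exists_solvesOn_or_reaches_sphere`: composing the field with
the coordinatewise clamp onto a small ball makes it globally Lipschitz and bounded, and a solution of
the clamped equation solves the original one until it meets the boundary of the ball.
-/

open Set Metric Filter Topology

/-! ### Solutions on a ball and conserved quantities -/

section Generic

theorem SolvesOn.continuousOn {E : Type*} [NormedAddCommGroup E] [NormedSpace ℝ E]
    {f : E → E} {T : ℝ} {y : E} {x : ℝ → E} (h : SolvesOn f T y x) : ContinuousOn x (Icc 0 T) :=
  fun t ht => (h.2 t ht).continuousWithinAt

theorem SolvesOn.mono {E : Type*} [NormedAddCommGroup E] [NormedSpace ℝ E]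
    {f : E → E} {T T' : ℝ} {y : E} {x : ℝ → E} (h : SolvesOn f T y x) (hT : T' ≤ T) :
    SolvesOn f T' y x :=
  ⟨h.1, fun t ht => (h.2 t ⟨ht.1, ht.2.trans hT⟩).mono (Icc_subset_Icc_right hT)⟩

/-- A function with vanishing derivative on `[0, T]` keeps its initial value. -/
theorem eq_initial_of_hasDerivWithinAt_zero {φ : ℝ → ℝ} {T : ℝ}
    (h : ∀ t ∈ Icc 0 T, HasDerivWithinAt φ 0 (Icc 0 T) t) : ∀ t ∈ Icc 0 T, φ t = φ 0 := by
  intro t ht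
  refine constant_of_derivWithin_zero (fun s hs => (h s hs).differentiableWithinAt) ?_ t ht
  intro s hs
  exact (h s (Ico_subset_Icc_self hs)).derivWithin
    (uniqueDiffOn_Icc (hs.1.trans_lt hs.2) s (Ico_subset_Icc_self hs))

/-- A curve that starts inside the ball and is not always inside it meets the sphere. -/
theorem exists_dist_eq_of_le {E : Type*} [PseudoMetricSpace E] {x : ℝ → E} {p : E} {r t : ℝ}
    (hx : ContinuousOn x (Icc 0 t)) (ht : 0 ≤ t) (h0 : dist (x 0) p ≤ r)
    (h : r ≤ dist (x t) p) : ∃ s ∈ Icc 0 t, dist (x s) p = r :=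
  intermediate_value_Icc ht (f := fun s => dist (x s) p)
    ((continuous_id.dist continuous_const).comp_continuousOn hx) ⟨h0, h⟩

/-- A globally Lipschitz bounded field has solutions on every interval `[0, T]`. -/
theorem exists_solvesOn_of_lipschitzWith {E : Type*} [NormedAddCommGroup E] [NormedSpace ℝ E]
    [CompleteSpace E] {f : E → E} {K L : NNReal} (hK : LipschitzWith K f) (hL : ∀ z, ‖f z‖ ≤ L)
    {T : ℝ} (hT : 0 ≤ T) (y : E) : ∃ x, SolvesOn f T y x := by
  have h : IsPicardLindelof (fun _ => f) (⟨0, le_rfl, hT⟩ : Icc 0 T) y (L * T.toNNReal) 0 L K := by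
    refine .of_time_independent (fun z _ => hL z) hK.lipschitzOnWith ?_
    simp [hT]
  exact h.exists_eq_forall_mem_Icc_hasDerivWithinAt₀

/-- The coordinatewise clamp onto the sup norm ball of radius `r` about `p`. -/
def clampBall {ι : Type*} (p : ι → ℝ) (r : ℝ) (z : ι → ℝ) : ι → ℝ :=
  fun i => max (p i - r) (min (p i + r) (z i))

theorem clampBall_of_mem {ι : Type*} [Fintype ι] {p z : ι → ℝ} {r : ℝ}
    (hz : z ∈ closedBall p r) : clampBall p r z = z := by
  funext i
  have h := (dist_le_pi_dist z p i).trans hz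
  rw [Real.dist_eq, abs_le] at h
  rw [clampBall, min_eq_right (by linarith), max_eq_right (by linarith)]

theorem clampBall_mem {ι : Type*} [Fintype ι] (p z : ι → ℝ) {r : ℝ} (hr : 0 ≤ r) :
    clampBall p r z ∈ closedBall p r := by
  rw [mem_closedBall, dist_pi_le_iff hr]
  intro i
  rw [Real.dist_eq, abs_le, clampBall]
  constructor
  · linarith [le_max_left (p i - r) (min (p i + r) (z i))]
  · linarith [max_le (show p i - r ≤ p i + r by linarith) (min_le_left (p i + r) (z i))]

theorem lipschitzWith_clampBall {ι : Type*} [Fintype ι] (p : ι → ℝ) (r : ℝ) :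
    LipschitzWith 1 (clampBall p r) := by
  refine LipschitzWith.of_edist_le fun z w => edist_pi_le_iff.2 fun i => ?_
  have h := ((LipschitzWith.eval (α := fun _ : ι => ℝ) i).const_min (p i + r)).const_max (p i - r)
  simpa [clampBall] using h z w

/-- Continuation up to the boundary: inside a ball on which the field is Lipschitz, a solution
either exists up to the prescribed time or reaches the bounding sphere. -/
theorem exists_solvesOn_or_reaches_sphere {ι : Type*} [Fintype ι] {f : (ι → ℝ) → (ι → ℝ)}
    {p y : ι → ℝ} {r T : ℝ} {K : NNReal} (hK : LipschitzOnWith K f (closedBall p r))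
    (hy : dist y p < r) (hT : 0 ≤ T) :
    ∃ x, ∃ T' ∈ Icc 0 T, SolvesOn f T' y x ∧ (∀ t ∈ Icc 0 T', dist (x t) p ≤ r) ∧
      (T' = T ∨ dist (x T') p = r) := by
  have hr : 0 ≤ r := dist_nonneg.trans hy.le
  -- The field composed with the clamp is globally Lipschitz and bounded, and agrees with `f`
  -- on the ball.
  have hlip : LipschitzWith (K * 1) (f ∘ clampBall p r) := lipschitzOnWith_univ.1 <|
    hK.comp (lipschitzWith_clampBall p r).lipschitzOnWith fun z _ => clampBall_mem p z hr
  have hbd : ∀ z, ‖(f ∘ clampBall p r) z‖ ≤ (‖f p‖₊ + K * r.toNNReal : NNReal) := by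
    intro z
    have h1 := hK.dist_le_mul _ (clampBall_mem p z hr) p (mem_closedBall_self hr)
    have h2 : (K : ℝ) * dist (clampBall p r z) p ≤ K * r :=
      mul_le_mul_of_nonneg_left (clampBall_mem p z hr) K.2
    rw [dist_eq_norm] at h1
    have h3 := norm_le_norm_add_norm_sub' (f (clampBall p r z)) (f p)
    simp only [Function.comp, NNReal.coe_add, NNReal.coe_mul, coe_nnnorm, Real.coe_toNNReal r hr]
    linarith
  obtain ⟨x, hx⟩ := exists_solvesOn_of_lipschitzWith hlip hbd hT y
  have hback : ∀ T' ∈ Icc 0 T, (∀ t ∈ Icc 0 T', dist (x t) p ≤ r) → SolvesOn f T' y x := by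
    intro T' hT' hin
    refine ⟨hx.1, fun t ht => ?_⟩
    have h := (hx.mono hT'.2).2 t ht
    rwa [Function.comp, clampBall_of_mem (hin t ht)] at h
  let S : Set ℝ := Icc 0 T ∩ (fun t => dist (x t) p) ⁻¹' Ici r
  have hS : IsCompact S := isCompact_Icc.of_isClosed_subset
    (((continuous_id.dist continuous_const).comp_continuousOn
      hx.continuousOn).preimage_isClosed_of_isClosed isClosed_Icc isClosed_Ici) inter_subset_left
  rcases S.eq_empty_or_nonempty with hemp | hne
  · have hin : ∀ t ∈ Icc 0 T, dist (x t) p ≤ r := by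
      intro t ht
      by_contra hlt
      exact (hemp ▸ (⟨ht, (not_le.1 hlt).le⟩ : t ∈ S) : t ∈ (∅ : Set ℝ))
    exact ⟨x, T, ⟨hT, le_rfl⟩, hback T ⟨hT, le_rfl⟩ hin, hin, Or.inl rfl⟩
  · obtain ⟨T', ⟨hT', hrT'⟩, hleast⟩ := hS.exists_isLeast hne
    obtain ⟨s, hs, hsr⟩ := exists_dist_eq_of_le (hx.mono hT'.2).continuousOn hT'.1
      (hx.1.symm ▸ hy.le) hrT'
    have hsT : T' ≤ s := hleast ⟨⟨hs.1, hs.2.trans hT'.2⟩, hsr.ge⟩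
    obtain rfl : s = T' := le_antisymm hs.2 hsT
    have hin : ∀ t ∈ Icc 0 s, dist (x t) p ≤ r := by
      intro t ht
      rcases ht.2.eq_or_lt with rfl | hlt
      · exact hsr.le
      · by_contra hcon
        exact absurd (hleast ⟨⟨ht.1, ht.2.trans hT'.2⟩, (not_le.1 hcon).le⟩) (not_le.2 hlt)
    exact ⟨x, s, hT', hback s hT' hin, hin, Or.inr hsr⟩

/-- **Stability from conserved quantities.** If `p` is isolated in its level set of a continuous
conserved quantity `Φ`, it is Lyapunov stable: on a small sphere about `p` the compact set of
values of `Φ` avoids `Φ p`, hence also `Φ y` for `y` near `p`, so that no solution from `y` meets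
the sphere. -/
theorem lyapunovStableOn_univ_of_conserved {ι F : Type*} [Fintype ι] [TopologicalSpace F]
    [T2Space F] {f : (ι → ℝ) → (ι → ℝ)} {Φ : (ι → ℝ) → F} {U : Set (ι → ℝ)} {p : ι → ℝ}
    (hf : ContDiffAt ℝ 1 f p) (hU : U ∈ 𝓝 p) (hΦ : ContinuousOn Φ U)
    (hcons : ∀ y ∈ U, ∀ T x, SolvesOn f T y x → ∀ t ∈ Icc 0 T, Φ (x t) = Φ y)
    (hiso : ∀ᶠ z in 𝓝 p, Φ z = Φ p → z = p) :
    LyapunovStableOn f univ p := by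
  intro ε hε
  obtain ⟨K, V, hV, hK⟩ := hf.exists_lipschitzOnWith
  obtain ⟨ρ, hρ, hball⟩ := Metric.nhds_basis_closedBall.mem_iff.1
    (inter_mem (inter_mem hU hV) hiso)
  obtain ⟨r, hr, hrlt⟩ := exists_between (lt_min hρ hε)
  have hsub : closedBall p r ⊆ closedBall p ρ :=
    closedBall_subset_closedBall (hrlt.le.trans (min_le_left _ _))
  have hsph : IsCompact (Φ '' sphere p r) := (isCompact_sphere p r).image_of_continuousOn
    (hΦ.mono fun z hz => (hball (hsub (sphere_subset_closedBall hz))).1.1)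
  have hp : Φ p ∉ Φ '' sphere p r := by
    rintro ⟨z, hz, hzp⟩
    have hz' : z = p := (hball (hsub (sphere_subset_closedBall hz))).2 hzp
    rw [hz', mem_sphere, dist_self] at hz
    exact hr.ne hz
  have hnear : ∀ᶠ y in 𝓝 p, Φ y ∉ Φ '' sphere p r :=
    (hΦ.continuousAt hU).eventually (hsph.isClosed.isOpen_compl.mem_nhds hp)
  obtain ⟨δ, hδ, hδball⟩ := Metric.eventually_nhds_iff.1 hnear
  refine ⟨min δ r, lt_min hδ hr, fun y _ hy T hT => ?_⟩
  have hyr : dist y p < r := hy.trans_le (min_le_right _ _)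
  have hyU : y ∈ U := (hball (hsub hyr.le)).1.1
  have havoid : ∀ T x, SolvesOn f T y x → ∀ t ∈ Icc 0 T, dist (x t) p ≠ r := by
    intro T x hx t ht heq
    exact hδball (hy.trans_le (min_le_left _ _)) ⟨x t, heq, hcons y hyU T x hx t ht⟩
  constructor
  · obtain ⟨x, T', hT', hx, -, h⟩ := exists_solvesOn_or_reaches_sphere
      (hK.mono fun z hz => (hball (hsub hz)).1.2) hyr hT
    rcases h with rfl | h
    · exact ⟨x, hx⟩
    · exact absurd h (havoid T' x hx T' ⟨hT'.1, le_rfl⟩)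
  · intro x hx t ht
    by_contra hcon
    have hge : r ≤ dist (x t) p := by linarith [min_le_right ρ ε]
    obtain ⟨s, hs, hsr⟩ := exists_dist_eq_of_le (hx.mono ht.2).continuousOn ht.1
      (hx.1.symm ▸ hyr.le) hge
    exact havoid T x hx s ⟨hs.1, hs.2.trans ht.2⟩ hsr

theorem LyapunovStableOn.mono {E : Type*} [NormedAddCommGroup E] [NormedSpace ℝ E]
    {f : E → E} {S S' : Set E} {p : E} (h : LyapunovStableOn f S p) (hS : S' ⊆ S) :
    LyapunovStableOn f S' p := by
  intro ε hε
  obtain ⟨δ, hδ, h⟩ := h ε hε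
  exact ⟨δ, hδ, fun y hy => h y (hS hy)⟩

theorem LyapunovUnstableOn.mono {E : Type*} [NormedAddCommGroup E] [NormedSpace ℝ E]
    {f : E → E} {S S' : Set E} {p : E} (h : LyapunovUnstableOn f S p) (hS : S ⊆ S') :
    LyapunovUnstableOn f S' p := by
  obtain ⟨ε, hε, h⟩ := h
  refine ⟨ε, hε, fun δ hδ => ?_⟩
  obtain ⟨y, hy, h⟩ := h δ hδ
  exact ⟨y, hS hy, h⟩

end Generic

/-! ### The conserved quantities of the pendulum skate -/

section Skate

/-- The squared length `Γ₂² + Γ₃²` of the vertical vector `Γ`. -/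
def skateNormSq (ζ : SkateState) : ℝ := ζ 3 ^ 2 + ζ 4 ^ 2

/-- The moment of inertia `I₂ Γ₂² + I₃ Γ₃²` about the vertical through the center of
mass. -/
def skateInertia (I₂ I₃ : ℝ) (ζ : SkateState) : ℝ := I₂ * ζ 3 ^ 2 + I₃ * ζ 4 ^ 2

/-- The angular momentum `(I₂ Γ₂² + I₃ Γ₃²) v²` about the vertical through the center of
mass. -/
def skateMomentum (I₂ I₃ : ℝ) (ζ : SkateState) : ℝ := ζ 1 * skateInertia I₂ I₃ ζ

/-- The velocity `(Γ₂² + Γ₃²) v³ + l v² Γ₂`; for unit `Γ` it is the component along the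
blade of the velocity of the center of mass. The factor `Γ₂² + Γ₃²` keeps the conservation laws
exact for `Γ` of arbitrary length. -/
def skateGlide (l : ℝ) (ζ : SkateState) : ℝ := skateNormSq ζ * ζ 2 + l * ζ 1 * ζ 3

/-- The antiderivative `∫₀^{Γ₂} ds / (I₃ N + (I₂ - I₃) s²)`, `N = Γ₂² + Γ₃²`, of the reciprocal
inertia, in closed form. -/
noncomputable def skateAngle (I₂ I₃ : ℝ) (ζ : SkateState) : ℝ :=
  Real.arctan (√((I₂ - I₃) / (I₃ * skateNormSq ζ)) * ζ 3) /
    (√((I₂ - I₃) / (I₃ * skateNormSq ζ)) * (I₃ * skateNormSq ζ))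

/-- The nonholonomic first integral that replaces the linear momentum along the blade:
the glide velocity changes at the rate `- l v² Γ₂'`, and `v²` is the constant momentum divided by the
inertia, a function of `Γ₂` alone. -/
noncomputable def skateGlideIntegral (l I₂ I₃ : ℝ) (ζ : SkateState) : ℝ :=
  skateGlide l ζ + l * skateMomentum I₂ I₃ ζ * skateAngle I₂ I₃ ζ

/-- The energy of the pendulum skate; the terms with `N = Γ₂² + Γ₃²` extend it to `Γ` of arbitrary
nonzero length, so that it is conserved there as well. -/
noncomputable def skateEnergy (m g l I₁ I₂ I₃ : ℝ) (ζ : SkateState) : ℝ :=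
  (I₁ + m * l ^ 2) * ζ 0 ^ 2 / 2
    + (1 + m * l ^ 2 * (1 - 1 / skateNormSq ζ) / (I₂ - I₃)) *
      (skateInertia I₂ I₃ ζ * ζ 1 ^ 2) / 2
    + m * skateGlide l ζ ^ 2 / (2 * skateNormSq ζ) + m * g * l * ζ 4

theorem skateInertia_eq (I₂ I₃ : ℝ) (ζ : SkateState) :
    skateInertia I₂ I₃ ζ = I₃ * skateNormSq ζ + (I₂ - I₃) * ζ 3 ^ 2 := by
  unfold skateInertia skateNormSq; ring

theorem skateInertia_pos {I₂ I₃ : ℝ} (hI₃ : 0 < I₃) (hI : I₃ < I₂) {ζ : SkateState}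
    (hζ : 0 < skateNormSq ζ) : 0 < skateInertia I₂ I₃ ζ := by
  rw [skateInertia_eq]
  have : 0 < I₂ - I₃ := sub_pos.2 hI
  positivity

variable {m g l I₁ I₂ I₃ T : ℝ} {y : SkateState} {x : ℝ → SkateState}

theorem SolvesOn.skate_hasDerivWithinAt (hx : SolvesOn (skateField m g l I₁ I₂ I₃) T y x)
    {t : ℝ} (ht : t ∈ Icc 0 T) (i : Fin 5) :
    HasDerivWithinAt (fun s => x s i) (skateField m g l I₁ I₂ I₃ (x t) i) (Icc 0 T) t :=
  hasDerivWithinAt_pi.1 (hx.2 t ht) i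

theorem SolvesOn.skateNormSq_eq (hx : SolvesOn (skateField m g l I₁ I₂ I₃) T y x)
    {t : ℝ} (ht : t ∈ Icc 0 T) : skateNormSq (x t) = skateNormSq y := by
  have h := eq_initial_of_hasDerivWithinAt_zero (φ := fun t => skateNormSq (x t)) (T := T) ?_ t ht
  · simpa only [hx.1] using h
  intro s hs
  have h3 := hx.skate_hasDerivWithinAt hs 3
  have h4 := hx.skate_hasDerivWithinAt hs 4
  refine ((h3.fun_pow 2).fun_add (h4.fun_pow 2)).congr_deriv ?_
  simp [skateField]
  ring

/-- Rate of change of the inertia about the vertical. -/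
theorem SolvesOn.hasDerivWithinAt_skateInertia
    (hx : SolvesOn (skateField m g l I₁ I₂ I₃) T y x) {t : ℝ} (ht : t ∈ Icc 0 T) :
    HasDerivWithinAt (fun s => skateInertia I₂ I₃ (x s))
      (2 * (I₂ - I₃) * x t 0 * x t 3 * x t 4) (Icc 0 T) t := by
  have h3 := hx.skate_hasDerivWithinAt ht 3
  have h4 := hx.skate_hasDerivWithinAt ht 4
  refine (((h3.fun_pow 2).const_mul I₂).fun_add ((h4.fun_pow 2).const_mul I₃)).congr_deriv ?_
  simp [skateField]
  ring

theorem SolvesOn.skateMomentum_eq (hI₃ : 0 < I₃) (hI : I₃ < I₂) (hy : 0 < skateNormSq y)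
    (hx : SolvesOn (skateField m g l I₁ I₂ I₃) T y x) {t : ℝ} (ht : t ∈ Icc 0 T) :
    skateMomentum I₂ I₃ (x t) = skateMomentum I₂ I₃ y := by
  have h := eq_initial_of_hasDerivWithinAt_zero (φ := fun t => skateMomentum I₂ I₃ (x t))
    (T := T) ?_ t ht
  · simpa only [hx.1] using h
  intro s hs
  have h1 := hx.skate_hasDerivWithinAt hs 1
  refine (h1.fun_mul (hx.hasDerivWithinAt_skateInertia hs)).congr_deriv ?_
  have hD : skateInertia I₂ I₃ (x s) ≠ 0 :=
    (skateInertia_pos hI₃ hI ((hx.skateNormSq_eq hs).symm ▸ hy)).ne'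
  have : skateField m g l I₁ I₂ I₃ (x s) 1 =
      2 * (I₃ - I₂) * x s 3 * x s 4 * x s 0 * x s 1 / skateInertia I₂ I₃ (x s) := rfl
  rw [this]
  field_simp
  ring

theorem SolvesOn.hasDerivWithinAt_skateGlide (hI₃ : 0 < I₃) (hI : I₃ < I₂)
    (hy : 0 < skateNormSq y) (hx : SolvesOn (skateField m g l I₁ I₂ I₃) T y x)
    {t : ℝ} (ht : t ∈ Icc 0 T) :
    HasDerivWithinAt (fun s => skateGlide l (x s)) (-(l * x t 0 * x t 1 * x t 4))
      (Icc 0 T) t := by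
  have h1 := hx.skate_hasDerivWithinAt ht 1
  have h2 := hx.skate_hasDerivWithinAt ht 2
  have h3 := hx.skate_hasDerivWithinAt ht 3
  have h : HasDerivWithinAt (fun s => skateNormSq y * x s 2 + l * x s 1 * x s 3) _ (Icc 0 T) t :=
    (h2.const_mul (skateNormSq y)).fun_add ((h1.const_mul l).fun_mul h3)
  refine (h.congr_deriv ?_).congr (fun s hs => by rw [skateGlide, hx.skateNormSq_eq hs])
    (by rw [skateGlide, hx.skateNormSq_eq ht])
  have hD : skateInertia I₂ I₃ (x t) ≠ 0 :=
    (skateInertia_pos hI₃ hI ((hx.skateNormSq_eq ht).symm ▸ hy)).ne'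
  have e1 : skateField m g l I₁ I₂ I₃ (x t) 1 =
      2 * (I₃ - I₂) * x t 3 * x t 4 * x t 0 * x t 1 / skateInertia I₂ I₃ (x t) := rfl
  have e2 : skateField m g l I₁ I₂ I₃ (x t) 2 =
      -(2 * l * I₃ * x t 4 * x t 0 * x t 1 / skateInertia I₂ I₃ (x t)) := rfl
  have e3 : skateField m g l I₁ I₂ I₃ (x t) 3 = x t 0 * x t 4 := rfl
  rw [e1, e2, e3]
  have hDe := skateInertia_eq I₂ I₃ (x t)
  rw [hx.skateNormSq_eq ht] at hDe
  field_simp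
  linear_combination (l * x t 0 * x t 1 * x t 4 * 2) * hDe

theorem SolvesOn.hasDerivWithinAt_skateAngle (hI₃ : 0 < I₃) (hI : I₃ < I₂)
    (hy : 0 < skateNormSq y) (hx : SolvesOn (skateField m g l I₁ I₂ I₃) T y x)
    {t : ℝ} (ht : t ∈ Icc 0 T) :
    HasDerivWithinAt (fun s => skateAngle I₂ I₃ (x s))
      (x t 0 * x t 4 / skateInertia I₂ I₃ (x t)) (Icc 0 T) t := by
  have h3 := hx.skate_hasDerivWithinAt ht 3
  have hpos : 0 < (I₂ - I₃) / (I₃ * skateNormSq y) :=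
    div_pos (sub_pos.2 hI) (mul_pos hI₃ hy)
  obtain ⟨k, hk⟩ : ∃ k, k = √((I₂ - I₃) / (I₃ * skateNormSq y)) := ⟨_, rfl⟩
  have hk0 : 0 < k := hk ▸ Real.sqrt_pos.2 hpos
  have hk2 : k ^ 2 * (I₃ * skateNormSq y) = I₂ - I₃ := by
    rw [hk, Real.sq_sqrt hpos.le, div_mul_cancel₀ _ (mul_pos hI₃ hy).ne']
  have h : HasDerivWithinAt
      (fun s => Real.arctan (k * x s 3) / (k * (I₃ * skateNormSq y))) _ (Icc 0 T) t :=
    ((h3.const_mul k).arctan).div_const _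
  refine (h.congr_deriv ?_).congr
    (fun s hs => by rw [skateAngle, hx.skateNormSq_eq hs, ← hk])
    (by rw [skateAngle, hx.skateNormSq_eq ht, ← hk])
  have hD := skateInertia_pos hI₃ hI ((hx.skateNormSq_eq ht).symm ▸ hy)
  have e3 : skateField m g l I₁ I₂ I₃ (x t) 3 = x t 0 * x t 4 := rfl
  have hDe := skateInertia_eq I₂ I₃ (x t)
  rw [hx.skateNormSq_eq ht] at hDe
  have hDk : skateInertia I₂ I₃ (x t) = I₃ * skateNormSq y * (1 + (k * x t 3) ^ 2) := by
    rw [hDe]; linear_combination (-(x t 3) ^ 2) * hk2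
  have h1 : (1 + (k * x t 3) ^ 2) ≠ 0 := by positivity
  rw [e3, hDk]
  field_simp

theorem SolvesOn.skateGlideIntegral_eq (hI₃ : 0 < I₃) (hI : I₃ < I₂) (hy : 0 < skateNormSq y)
    (hx : SolvesOn (skateField m g l I₁ I₂ I₃) T y x) {t : ℝ} (ht : t ∈ Icc 0 T) :
    skateGlideIntegral l I₂ I₃ (x t) = skateGlideIntegral l I₂ I₃ y := by
  have h := eq_initial_of_hasDerivWithinAt_zero (φ := fun t => skateGlideIntegral l I₂ I₃ (x t))
    (T := T) ?_ t ht
  · simpa only [hx.1] using h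
  intro s hs
  have h1 := (hx.hasDerivWithinAt_skateGlide hI₃ hI hy hs).fun_add
    ((hx.hasDerivWithinAt_skateAngle hI₃ hI hy hs).const_mul (l * skateMomentum I₂ I₃ y))
  refine (h1.congr_deriv ?_).congr
    (fun s hs => by rw [skateGlideIntegral, hx.skateMomentum_eq hI₃ hI hy hs])
    (by rw [skateGlideIntegral, hx.skateMomentum_eq hI₃ hI hy hs])
  have hD : skateInertia I₂ I₃ (x s) ≠ 0 :=
    (skateInertia_pos hI₃ hI ((hx.skateNormSq_eq hs).symm ▸ hy)).ne'
  rw [← hx.skateMomentum_eq hI₃ hI hy hs, skateMomentum]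
  field_simp
  ring

theorem SolvesOn.skateEnergy_eq (hI₁ : I₁ + m * l ^ 2 ≠ 0) (hI₃ : 0 < I₃) (hI : I₃ < I₂)
    (hy : 0 < skateNormSq y) (hx : SolvesOn (skateField m g l I₁ I₂ I₃) T y x)
    {t : ℝ} (ht : t ∈ Icc 0 T) :
    skateEnergy m g l I₁ I₂ I₃ (x t) = skateEnergy m g l I₁ I₂ I₃ y := by
  have h := eq_initial_of_hasDerivWithinAt_zero (φ := fun t => skateEnergy m g l I₁ I₂ I₃ (x t))
    (T := T) ?_ t ht
  · simpa only [hx.1] using h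
  intro s hs
  have h0 := hx.skate_hasDerivWithinAt hs 0
  have h1 := hx.skate_hasDerivWithinAt hs 1
  have h4 := hx.skate_hasDerivWithinAt hs 4
  have hd := hx.hasDerivWithinAt_skateGlide hI₃ hI hy hs
  have hD' := hx.hasDerivWithinAt_skateInertia hs
  have h : HasDerivWithinAt (fun s => (I₁ + m * l ^ 2) * x s 0 ^ 2 / 2
    + (1 + m * l ^ 2 * (1 - 1 / skateNormSq y) / (I₂ - I₃)) *
      (skateInertia I₂ I₃ (x s) * x s 1 ^ 2) / 2
    + m * skateGlide l (x s) ^ 2 / (2 * skateNormSq y) + m * g * l * x s 4) _ (Icc 0 T) s :=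
    (((((h0.fun_pow 2).const_mul _).div_const 2).fun_add
      (((hD'.fun_mul (h1.fun_pow 2)).const_mul _).div_const 2)).fun_add
      (((hd.fun_pow 2).const_mul m).div_const _)).fun_add (h4.const_mul _)
  refine (h.congr_deriv ?_).congr
    (fun s hs => by rw [skateEnergy, hx.skateNormSq_eq hs])
    (by rw [skateEnergy, hx.skateNormSq_eq hs])
  have hD : skateInertia I₂ I₃ (x s) ≠ 0 :=
    (skateInertia_pos hI₃ hI ((hx.skateNormSq_eq hs).symm ▸ hy)).ne'
  have e0 : skateField m g l I₁ I₂ I₃ (x s) 0 =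
      ((((I₂ + m * l ^ 2) - I₃) * x s 4 * x s 1 ^ 2 + m * g * l) * x s 3
        + m * l * x s 4 * x s 1 * x s 2) / (I₁ + m * l ^ 2) := rfl
  have e1 : skateField m g l I₁ I₂ I₃ (x s) 1 =
      2 * (I₃ - I₂) * x s 3 * x s 4 * x s 0 * x s 1 / skateInertia I₂ I₃ (x s) := rfl
  have e4 : skateField m g l I₁ I₂ I₃ (x s) 4 = -(x s 0 * x s 3) := rfl
  have hI' : I₂ - I₃ ≠ 0 := (sub_pos.2 hI).ne'
  have hN := hy.ne'
  rw [e0, e1, e4, skateGlide, hx.skateNormSq_eq hs]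
  obtain ⟨n, hn⟩ : ∃ n, n = skateNormSq y := ⟨_, rfl⟩
  obtain ⟨d, hd⟩ : ∃ d, d = I₂ - I₃ := ⟨_, rfl⟩
  have hI₂ : I₂ = d + I₃ := by linarith
  rw [← hn] at hN ⊢
  rw [← hd] at hI' ⊢
  rw [hI₂] at hD ⊢
  field_simp
  ring

/-- The four conserved quantities, as a single map. -/
noncomputable def skateIntegrals (m g l I₁ I₂ I₃ : ℝ) (ζ : SkateState) : ℝ × ℝ × ℝ × ℝ :=
  (skateNormSq ζ, skateMomentum I₂ I₃ ζ, skateGlideIntegral l I₂ I₃ ζ,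
    skateEnergy m g l I₁ I₂ I₃ ζ)

theorem continuousOn_skateIntegrals (hI₃ : 0 < I₃) (hI : I₃ < I₂) :
    ContinuousOn (skateIntegrals m g l I₁ I₂ I₃) {ζ | 0 < skateNormSq ζ} := by
  have hn : Continuous skateNormSq := by unfold skateNormSq; fun_prop
  have hD : Continuous (skateInertia I₂ I₃) := by unfold skateInertia; fun_prop
  have hd : Continuous (skateGlide l) := by unfold skateGlide; fun_prop
  have hM : Continuous (skateMomentum I₂ I₃) := by unfold skateMomentum; fun_prop
  intro ζ hζ
  have hζ : 0 < skateNormSq ζ := hζ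
  have hn' : skateNormSq ζ ≠ 0 := hζ.ne'
  have h2n : 2 * skateNormSq ζ ≠ 0 := by positivity
  have hIn : I₃ * skateNormSq ζ ≠ 0 := by positivity
  have hk : √((I₂ - I₃) / (I₃ * skateNormSq ζ)) * (I₃ * skateNormSq ζ) ≠ 0 :=
    mul_ne_zero (Real.sqrt_pos.2 (div_pos (sub_pos.2 hI) (mul_pos hI₃ hζ))).ne' hIn
  have hA : ContinuousAt (skateAngle I₂ I₃) ζ := by
    unfold skateAngle
    have hs : ContinuousAt (fun z => √((I₂ - I₃) / (I₃ * skateNormSq z))) ζ :=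
      ContinuousAt.sqrt (ContinuousAt.div continuousAt_const (by fun_prop) hIn)
    have h3 : ContinuousAt (fun z : SkateState => z 3) ζ := (continuous_apply 3).continuousAt
    exact (Real.continuous_arctan.continuousAt.comp (hs.mul h3)).div
      (hs.mul (by fun_prop)) hk
  have hE : ContinuousAt (skateEnergy m g l I₁ I₂ I₃) ζ := by
    have e1 : ContinuousAt (fun z => 1 / skateNormSq z) ζ :=
      ContinuousAt.div continuousAt_const hn.continuousAt hn'
    have e2 : ContinuousAt (fun z => m * skateGlide l z ^ 2 / (2 * skateNormSq z)) ζ :=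
      ContinuousAt.div (by fun_prop) (by fun_prop) h2n
    have h4 : ContinuousAt (fun z : SkateState => z 4) ζ := (continuous_apply 4).continuousAt
    have e0 : ContinuousAt (fun z : SkateState => (I₁ + m * l ^ 2) * z 0 ^ 2) ζ :=
      (((continuous_apply 0).pow 2).const_mul _).continuousAt
    have e3 : ContinuousAt (fun z => (1 + m * l ^ 2 * (1 - 1 / skateNormSq z) / (I₂ - I₃)) *
        (skateInertia I₂ I₃ z * z 1 ^ 2)) ζ :=
      (continuousAt_const.add
        (ContinuousAt.div_const ((continuousAt_const.sub e1).const_mul (m * l ^ 2)) _)).mul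
        (hD.mul ((continuous_apply 1).pow 2)).continuousAt
    exact (((e0.div_const 2).add (e3.div_const 2)).add e2).add
      (h4.const_mul (m * g * l))
  have hW : ContinuousAt (skateGlideIntegral l I₂ I₃) ζ := by
    unfold skateGlideIntegral
    fun_prop
  exact (hn.continuousAt.prodMk (hM.continuousAt.prodMk (hW.prodMk hE))).continuousWithinAt

theorem contDiffAt_skateField (m g l I₁ I₂ : ℝ) {I₃ : ℝ} {ζ : SkateState}
    (hζ : skateInertia I₂ I₃ ζ ≠ 0) : ContDiffAt ℝ 1 (skateField m g l I₁ I₂ I₃) ζ := by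
  unfold skateInertia at hζ
  have hc : ∀ i : Fin 5, ContDiffAt ℝ 1 (fun z : SkateState => z i) ζ := fun i =>
    (contDiff_apply ℝ ℝ i).contDiffAt
  have h0 := hc 0
  have h1 := hc 1
  have h2 := hc 2
  have h3 := hc 3
  have h4 := hc 4
  rw [contDiffAt_pi]
  intro i
  fin_cases i
  · simp only [skateField]
    simp
    fun_prop
  · simp only [skateField]
    simp
    fun_prop (disch := assumption)
  · simp only [skateField]
    simp
    fun_prop (disch := assumption)
  · simp only [skateField]
    simp
    fun_prop
  · simp only [skateField]
    simp
    fun_prop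

end Skate

/-! ### The reduced potential near the upright state -/

section Potential

theorem Real.arctan_sq_le (x : ℝ) : Real.arctan x ^ 2 ≤ x ^ 2 := by
  have key : ∀ z : ℝ, 0 ≤ z → Real.arctan z ≤ z := by
    intro z hz
    simpa using Real.le_tan (Real.arctan_nonneg.2 hz) (Real.arctan_lt_pi_div_two z)
  rw [sq_le_sq]
  rcases le_total 0 x with hx | hx
  · rw [abs_of_nonneg (Real.arctan_nonneg.2 hx), abs_of_nonneg hx]
    exact key x hx
  · have h := key (-x) (neg_nonneg.2 hx)
    have h0 := Real.arctan_nonneg.2 (neg_nonneg.2 hx)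
    rw [Real.arctan_neg] at h h0
    rw [abs_of_nonpos (by linarith), abs_of_nonpos hx]
    exact h

/-- With `x = tan θ` this is `sin θ ^ 2 * cos θ ^ 2 ≤ θ ^ 2`. -/
theorem Real.sq_div_one_add_sq_le_arctan_sq (x : ℝ) :
    (x / (1 + x ^ 2)) ^ 2 ≤ Real.arctan x ^ 2 := by
  have h1 : (x / (1 + x ^ 2)) ^ 2 = Real.sin (Real.arctan x) ^ 2 * Real.cos (Real.arctan x) ^ 2 := by
    rw [Real.sin_sq_arctan, Real.cos_sq_arctan]
    have : 1 + x ^ 2 ≠ 0 := by positivity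
    field_simp
  have h2 : Real.sin (Real.arctan x) ^ 2 ≤ Real.arctan x ^ 2 := sq_le_sq.2 Real.abs_sin_le_abs
  rw [h1]
  nlinarith [Real.cos_sq_le_one (Real.arctan x), sq_nonneg (Real.sin (Real.arctan x))]

variable {m g l I₁ I₂ I₃ Ω₀ : ℝ} {ζ : SkateState}

/-- The antiderivative of `1 / D` lies between `Γ₂ / D(Γ₂)` and `Γ₂ / D(0)`, since the inertia `D`
increases with `|Γ₂|`. -/
theorem skateAngle_sq_bounds (hI₃ : 0 < I₃) (hI : I₃ < I₂) (hζ : 0 < skateNormSq ζ) :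
    (ζ 3 / skateInertia I₂ I₃ ζ) ^ 2 ≤ skateAngle I₂ I₃ ζ ^ 2 ∧
      skateAngle I₂ I₃ ζ ^ 2 ≤ (ζ 3 / (I₃ * skateNormSq ζ)) ^ 2 := by
  have hn : 0 < I₃ * skateNormSq ζ := mul_pos hI₃ hζ
  have hpos : 0 < (I₂ - I₃) / (I₃ * skateNormSq ζ) := div_pos (sub_pos.2 hI) hn
  unfold skateAngle
  rw [skateInertia_eq]
  have hk0 := Real.sqrt_pos.2 hpos
  have hk2 : √((I₂ - I₃) / (I₃ * skateNormSq ζ)) ^ 2 * (I₃ * skateNormSq ζ) = I₂ - I₃ := by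
    rw [Real.sq_sqrt hpos.le, div_mul_cancel₀ _ hn.ne']
  generalize √((I₂ - I₃) / (I₃ * skateNormSq ζ)) = k at *
  generalize I₃ * skateNormSq ζ = n at *
  rw [← hk2]
  constructor
  · have h := Real.sq_div_one_add_sq_le_arctan_sq (k * ζ 3)
    have e : ζ 3 / (n + k ^ 2 * n * ζ 3 ^ 2) =
        (k * ζ 3 / (1 + (k * ζ 3) ^ 2)) / (k * n) := by
      have h1 : 1 + (k * ζ 3) ^ 2 ≠ 0 := by positivity
      have h2 : n + k ^ 2 * n * ζ 3 ^ 2 ≠ 0 := by positivity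
      field_simp
    rw [e, div_pow _ (k * n), div_pow _ (k * n)]
    gcongr
  · have h := Real.arctan_sq_le (k * ζ 3)
    have e : ζ 3 / n = k * ζ 3 / (k * n) := by field_simp
    rw [e, div_pow _ (k * n), div_pow _ (k * n)]
    gcongr

/-- On the common level set of length, momentum and glide integral through the upright spinning
state, the energy is the kinetic energy of the tilting motion plus a potential of the tilt. -/
theorem skateEnergy_reduced (hI₃ : 0 < I₃) (hI : I₃ < I₂) (hN : skateNormSq ζ = 1)
    (hM : skateMomentum I₂ I₃ ζ = Ω₀ * I₃) (hW : skateGlideIntegral l I₂ I₃ ζ = 0) :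
    2 * skateEnergy m g l I₁ I₂ I₃ ζ = I₃ * Ω₀ ^ 2 + 2 * (m * g * l) +
      (I₁ + m * l ^ 2) * ζ 0 ^ 2 +
      Ω₀ ^ 2 * (m * l ^ 2 * I₃ ^ 2 * skateAngle I₂ I₃ ζ ^ 2 -
        (I₂ - I₃) * I₃ * ζ 3 ^ 2 / skateInertia I₂ I₃ ζ) -
      2 * (m * g * l) * (1 - ζ 4) := by
  have hD : 0 < skateInertia I₂ I₃ ζ := skateInertia_pos hI₃ hI (hN ▸ one_pos)
  have hDe := skateInertia_eq I₂ I₃ ζ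
  rw [hN] at hDe
  rw [skateGlideIntegral, hM] at hW
  have hu : skateGlide l ζ = -(l * (Ω₀ * I₃) * skateAngle I₂ I₃ ζ) := by linarith
  have hb : ζ 1 = Ω₀ * I₃ / skateInertia I₂ I₃ ζ := by
    rw [eq_div_iff hD.ne']; exact hM
  rw [skateEnergy, hN, hu, hb]
  field_simp
  linear_combination (-(Ω₀ ^ 2 * I₃)) * hDe

theorem skateNormSq_spinningState : skateNormSq (spinningState Ω₀) = 1 := by
  simp [skateNormSq, spinningState]

theorem skateInertia_spinningState : skateInertia I₂ I₃ (spinningState Ω₀) = I₃ := by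
  simp [skateInertia, spinningState]

theorem continuous_skateInertia : Continuous (skateInertia I₂ I₃) := by
  unfold skateInertia; fun_prop

theorem skateField_spinningState : skateField m g l I₁ I₂ I₃ (spinningState Ω₀) = 0 := by
  funext i
  fin_cases i <;> simp [skateField, spinningState]

theorem contDiffAt_skateField_spinningState (hI₃ : 0 < I₃) :
    ContDiffAt ℝ 1 (skateField m g l I₁ I₂ I₃) (spinningState Ω₀) :=
  contDiffAt_skateField m g l I₁ I₂ (by rw [skateInertia_spinningState]; exact hI₃.ne')

/-- The upright spinning state with an added tilting velocity `s`. -/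
def tiltedSpinningState (Ω₀ s : ℝ) : SkateState := ![s, Ω₀, 0, 0, 1]

theorem tiltedSpinningState_zero : tiltedSpinningState Ω₀ 0 = spinningState Ω₀ := rfl

theorem skateIntegrals_tiltedSpinningState (s : ℝ) :
    skateIntegrals m g l I₁ I₂ I₃ (tiltedSpinningState Ω₀ s) =
      (1, Ω₀ * I₃, 0, (I₁ + m * l ^ 2) * s ^ 2 / 2 + I₃ * Ω₀ ^ 2 / 2 + m * g * l) := by
  simp [skateIntegrals, skateNormSq, skateMomentum, skateInertia, skateGlideIntegral, skateGlide,
    skateAngle, skateEnergy, tiltedSpinningState]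

/-- Fast spinning makes the upright state a strict minimum of the reduced potential, hence
isolated in its level set. -/
theorem eventually_eq_spinningState_of_skateIntegrals_eq (hm : 0 < m) (hI₁ : 0 < I₁)
    (hI₃ : 0 < I₃) (hI : I₃ < I₂) (hΩ : m * g * l < Ω₀ ^ 2 * (I₃ + m * l ^ 2 - I₂)) :
    ∀ᶠ ζ in 𝓝 (spinningState Ω₀),
      skateIntegrals m g l I₁ I₂ I₃ ζ = skateIntegrals m g l I₁ I₂ I₃ (spinningState Ω₀) →
        ζ = spinningState Ω₀ := by
  have h4 : ContinuousAt (fun ζ : SkateState => ζ 4) (spinningState Ω₀) :=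
    (continuous_apply 4).continuousAt
  have hDc : ContinuousAt (skateInertia I₂ I₃) (spinningState Ω₀) :=
    continuous_skateInertia.continuousAt
  have hpos : ∀ᶠ ζ in 𝓝 (spinningState Ω₀), 0 < ζ 4 :=
    h4.eventually (lt_mem_nhds (by simp [spinningState]))
  -- the comparison of the quadratic coefficients of the potential, with the tilt as a parameter
  have hineq : ∀ᶠ ζ in 𝓝 (spinningState Ω₀), 2 * (m * g * l) / (1 + ζ 4) <
      Ω₀ ^ 2 * (m * l ^ 2 * I₃ ^ 2 / skateInertia I₂ I₃ ζ ^ 2 -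
        (I₂ - I₃) * I₃ / skateInertia I₂ I₃ ζ) := by
    have hD0 : skateInertia I₂ I₃ (spinningState Ω₀) ≠ 0 := by
      rw [skateInertia_spinningState]; exact hI₃.ne'
    have hD2 : skateInertia I₂ I₃ (spinningState Ω₀) ^ 2 ≠ 0 := pow_ne_zero 2 hD0
    have h40 : 1 + spinningState Ω₀ 4 ≠ 0 := by simp [spinningState]
    refine ContinuousAt.eventually_lt
      (ContinuousAt.div continuousAt_const (continuousAt_const.add h4) h40)
      (by fun_prop (disch := assumption)) ?_
    rw [skateInertia_spinningState]
    have e1 : spinningState Ω₀ 4 = 1 := rfl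
    have e2 : m * l ^ 2 * I₃ ^ 2 / I₃ ^ 2 - (I₂ - I₃) * I₃ / I₃ = I₃ + m * l ^ 2 - I₂ := by
      field_simp; ring
    rw [e1, e2]
    linarith
  filter_upwards [hpos, hineq] with ζ hz hlt heq
  rw [← tiltedSpinningState_zero, skateIntegrals_tiltedSpinningState] at heq
  simp only [skateIntegrals, Prod.mk.injEq] at heq
  obtain ⟨hN, hM, hW, hE⟩ := heq
  have hD : 0 < skateInertia I₂ I₃ ζ := skateInertia_pos hI₃ hI (hN ▸ one_pos)
  have hred := skateEnergy_reduced (m := m) (g := g) (I₁ := I₁) hI₃ hI hN hM hW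
  have hA := (skateAngle_sq_bounds hI₃ hI (hN ▸ one_pos)).1
  have hNe : ζ 3 ^ 2 + ζ 4 ^ 2 = 1 := hN
  have hI₁' : 0 < I₁ + m * l ^ 2 := by positivity
  have hy : ζ 3 = 0 := by
    by_contra hne
    have hy2 : 0 < ζ 3 ^ 2 := by positivity
    have h1 := mul_lt_mul_of_pos_right hlt hy2
    have e1 : 2 * (m * g * l) / (1 + ζ 4) * ζ 3 ^ 2 = 2 * (m * g * l) * (1 - ζ 4) := by
      field_simp
      linear_combination (g * l) * hNe
    have h2 : Ω₀ ^ 2 * (m * l ^ 2 * I₃ ^ 2 / skateInertia I₂ I₃ ζ ^ 2 -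
        (I₂ - I₃) * I₃ / skateInertia I₂ I₃ ζ) * ζ 3 ^ 2 ≤
        Ω₀ ^ 2 * (m * l ^ 2 * I₃ ^ 2 * skateAngle I₂ I₃ ζ ^ 2 -
        (I₂ - I₃) * I₃ * ζ 3 ^ 2 / skateInertia I₂ I₃ ζ) := by
      rw [mul_assoc]
      refine mul_le_mul_of_nonneg_left ?_ (sq_nonneg _)
      have h3 := mul_le_mul_of_nonneg_left hA (show 0 ≤ m * l ^ 2 * I₃ ^ 2 by positivity)
      have e3 : (m * l ^ 2 * I₃ ^ 2 / skateInertia I₂ I₃ ζ ^ 2 -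
        (I₂ - I₃) * I₃ / skateInertia I₂ I₃ ζ) * ζ 3 ^ 2 =
        m * l ^ 2 * I₃ ^ 2 * (ζ 3 / skateInertia I₂ I₃ ζ) ^ 2 -
        (I₂ - I₃) * I₃ * ζ 3 ^ 2 / skateInertia I₂ I₃ ζ := by field_simp
      linarith
    have h4 : 0 ≤ (I₁ + m * l ^ 2) * ζ 0 ^ 2 := by positivity
    linarith
  have hz1 : ζ 4 = 1 := by
    rw [hy] at hNe
    nlinarith
  have hA0 : skateAngle I₂ I₃ ζ = 0 := by simp [skateAngle, hy]
  have ha : ζ 0 = 0 := by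
    rw [hA0, hy, hz1] at hred
    have : (I₁ + m * l ^ 2) * ζ 0 ^ 2 = 0 := by linear_combination 2 * hE - hred
    simpa [hI₁'.ne'] using this
  have hb : ζ 1 = Ω₀ := by
    have : ζ 1 * I₃ = Ω₀ * I₃ := by
      simpa [skateMomentum, skateInertia, hy, hz1] using hM
    exact mul_right_cancel₀ hI₃.ne' this
  have hc : ζ 2 = 0 := by
    simpa [skateGlideIntegral, skateGlide, hA0, hN, hy] using hW
  funext i
  fin_cases i <;> simp [spinningState, ha, hb, hc, hy, hz1]

/-- Below the inertia threshold the upright state maximizes the reduced potential, so the tilting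
velocity cannot drop below its value at the upright state. -/
theorem sq_le_sq_of_skateIntegrals_eq (hm : 0 < m) (hg : 0 < g) (hl : 0 < l) (hI₁ : 0 < I₁)
    (hI₃ : 0 < I₃) (hI : I₃ < I₂) {s : ℝ}
    (hζ : m * l ^ 2 * skateInertia I₂ I₃ ζ ≤ (I₂ - I₃) * I₃)
    (heq : skateIntegrals m g l I₁ I₂ I₃ ζ =
      skateIntegrals m g l I₁ I₂ I₃ (tiltedSpinningState Ω₀ s)) : s ^ 2 ≤ ζ 0 ^ 2 := by
  rw [skateIntegrals_tiltedSpinningState] at heq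
  simp only [skateIntegrals, Prod.mk.injEq] at heq
  obtain ⟨hN, hM, hW, hE⟩ := heq
  have hD : 0 < skateInertia I₂ I₃ ζ := skateInertia_pos hI₃ hI (hN ▸ one_pos)
  have hred := skateEnergy_reduced (m := m) (g := g) (I₁ := I₁) hI₃ hI hN hM hW
  have hA := (skateAngle_sq_bounds hI₃ hI (hN ▸ one_pos)).2
  have hNe : ζ 3 ^ 2 + ζ 4 ^ 2 = 1 := hN
  have hz : ζ 4 ≤ 1 := by nlinarith [sq_nonneg (ζ 3)]
  have hpot : m * l ^ 2 * I₃ ^ 2 * skateAngle I₂ I₃ ζ ^ 2 ≤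
      (I₂ - I₃) * I₃ * ζ 3 ^ 2 / skateInertia I₂ I₃ ζ := by
    rw [le_div_iff₀ hD]
    have h1 : m * l ^ 2 * I₃ ^ 2 * skateAngle I₂ I₃ ζ ^ 2 ≤ m * l ^ 2 * ζ 3 ^ 2 := by
      have h2 := mul_le_mul_of_nonneg_left hA (show 0 ≤ m * l ^ 2 * I₃ ^ 2 by positivity)
      rw [hN] at h2
      refine h2.trans_eq ?_
      field_simp
    have h3 := mul_le_mul_of_nonneg_right h1 hD.le
    have h4 := mul_le_mul_of_nonneg_right hζ (sq_nonneg (ζ 3))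
    linarith
  have hI₁' : 0 < I₁ + m * l ^ 2 := by positivity
  have hgz : 0 ≤ 2 * (m * g * l) * (1 - ζ 4) := mul_nonneg (by positivity) (by linarith)
  have hp := mul_nonneg (sq_nonneg Ω₀) (sub_nonneg.2 hpot)
  refine le_of_mul_le_mul_left ?_ hI₁'
  linarith

end Potential

/-! ### Stability and instability of the upright spinning state -/

section Stability

variable {m g l I₁ I₂ I₃ T : ℝ} {y : SkateState} {x : ℝ → SkateState}

theorem SolvesOn.skateIntegrals_eq (hI₁ : I₁ + m * l ^ 2 ≠ 0) (hI₃ : 0 < I₃) (hI : I₃ < I₂)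
    (hy : 0 < skateNormSq y) (hx : SolvesOn (skateField m g l I₁ I₂ I₃) T y x)
    {t : ℝ} (ht : t ∈ Icc 0 T) :
    skateIntegrals m g l I₁ I₂ I₃ (x t) = skateIntegrals m g l I₁ I₂ I₃ y := by
  rw [skateIntegrals, skateIntegrals, hx.skateNormSq_eq ht, hx.skateMomentum_eq hI₃ hI hy ht,
    hx.skateGlideIntegral_eq hI₃ hI hy ht, hx.skateEnergy_eq hI₁ hI₃ hI hy ht]

theorem lyapunovStableOn_skateField (hm : 0 < m) (hI₁ : 0 < I₁) (hI₃ : 0 < I₃) (hI : I₃ < I₂)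
    {Ω₀ : ℝ} (hΩ : m * g * l < Ω₀ ^ 2 * (I₃ + m * l ^ 2 - I₂)) :
    LyapunovStableOn (skateField m g l I₁ I₂ I₃) univ (spinningState Ω₀) := by
  have hcont : Continuous skateNormSq := by unfold skateNormSq; fun_prop
  have hI₁' : 0 < I₁ + m * l ^ 2 := by positivity
  refine lyapunovStableOn_univ_of_conserved (U := {ζ | 0 < skateNormSq ζ})
    (contDiffAt_skateField_spinningState hI₃) ?_ (continuousOn_skateIntegrals hI₃ hI)
    (fun y hy T x hx t ht => hx.skateIntegrals_eq hI₁'.ne' hI₃ hI hy ht)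
    (eventually_eq_spinningState_of_skateIntegrals_eq hm hI₁ hI₃ hI hΩ)
  exact (isOpen_lt continuous_const hcont).mem_nhds
    (by rw [mem_ofPred_eq, skateNormSq_spinningState]; exact one_pos)

/-- A solution started upright with tilting velocity `s > 0` keeps at least this velocity while it
stays near the upright state, so its tilt grows at least linearly. -/
theorem SolvesOn.mul_le_tilt (hm : 0 < m) (hg : 0 < g) (hl : 0 < l) (hI₁ : 0 < I₁)
    (hI₃ : 0 < I₃) (hI : I₃ < I₂) {Ω₀ s : ℝ} (hs : 0 < s) (hT : 0 ≤ T)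
    (hx : SolvesOn (skateField m g l I₁ I₂ I₃) T (tiltedSpinningState Ω₀ s) x)
    (hin : ∀ t ∈ Icc 0 T, m * l ^ 2 * skateInertia I₂ I₃ (x t) ≤ (I₂ - I₃) * I₃)
    (hup : ∀ t ∈ Icc 0 T, 1 / 2 ≤ x t 4) : s / 2 * T ≤ x T 3 := by
  have hI₁' : 0 < I₁ + m * l ^ 2 := by positivity
  have hcoord : ∀ i, ContinuousOn (fun t => x t i) (Icc 0 T) := fun i =>
    (continuous_apply i).comp_continuousOn hx.continuousOn
  have hx0 : x 0 0 = s := by rw [hx.1]; rfl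
  have hsq : ∀ t ∈ Icc 0 T, s ^ 2 ≤ x t 0 ^ 2 := fun t ht =>
    sq_le_sq_of_skateIntegrals_eq hm hg hl hI₁ hI₃ hI (hin t ht)
      (hx.skateIntegrals_eq hI₁'.ne' hI₃ hI (by simp [skateNormSq, tiltedSpinningState]) ht)
  have hvel : ∀ t ∈ Icc 0 T, s ≤ x t 0 := by
    intro t ht
    refine le_of_sq_le_sq (hsq t ht) ?_
    -- the tilting velocity never vanishes, hence keeps its sign
    by_contra hneg
    obtain ⟨τ, hτ, hτ0⟩ := intermediate_value_Icc' ht.1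
      ((hcoord 0).mono (Icc_subset_Icc_right ht.2))
      (show (0 : ℝ) ∈ Icc (x t 0) (x 0 0) from ⟨(not_le.1 hneg).le, hx0 ▸ hs.le⟩)
    have h := hsq τ ⟨hτ.1, hτ.2.trans ht.2⟩
    simp only at hτ0
    rw [hτ0] at h
    nlinarith
  have hmono : MonotoneOn (fun t => x t 3 - s / 2 * t) (Icc 0 T) := by
    refine monotoneOn_of_hasDerivWithinAt_nonneg (convex_Icc 0 T)
      (f' := fun t => x t 0 * x t 4 - s / 2 * 1)
      ((hcoord 3).sub (continuousOn_const.mul continuousOn_id)) (fun t ht => ?_) (fun t ht => ?_)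
    · exact ((hx.skate_hasDerivWithinAt (interior_subset ht) 3).fun_sub
        ((hasDerivWithinAt_id t _).const_mul (s / 2))).mono interior_subset
    · have h0 := hvel t (interior_subset ht)
      have h4 := hup t (interior_subset ht)
      nlinarith
  have h := hmono ⟨le_rfl, hT⟩ ⟨hT, le_rfl⟩ hT
  have hx3 : x 0 3 = 0 := by rw [hx.1]; rfl
  simp only [hx3] at h
  linarith

theorem lyapunovUnstableOn_skateField (hm : 0 < m) (hg : 0 < g) (hl : 0 < l) (hI₁ : 0 < I₁)
    (hI₃ : 0 < I₃) (hI : I₃ < I₂) (hlt : I₃ + m * l ^ 2 < I₂) (Ω₀ : ℝ) :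
    LyapunovUnstableOn (skateField m g l I₁ I₂ I₃) unitStates (spinningState Ω₀) := by
  obtain ⟨K, V, hV, hK⟩ :=
    (contDiffAt_skateField_spinningState (m := m) (g := g) (l := l) (I₁ := I₁) (I₂ := I₂)
      (Ω₀ := Ω₀) hI₃).exists_lipschitzOnWith
  have hin : ∀ᶠ ζ in 𝓝 (spinningState Ω₀),
      m * l ^ 2 * skateInertia I₂ I₃ ζ < (I₂ - I₃) * I₃ := by
    refine (continuous_skateInertia.const_mul _).continuousAt.eventually_lt continuousAt_const ?_
    rw [skateInertia_spinningState]
    exact mul_lt_mul_of_pos_right (by linarith) hI₃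
  have hup : ∀ᶠ ζ in 𝓝 (spinningState Ω₀), 1 / 2 < ζ 4 :=
    (continuous_apply 4).continuousAt.eventually (lt_mem_nhds one_half_lt_one)
  obtain ⟨r, hr, hball⟩ := Metric.nhds_basis_closedBall.mem_iff.1
    (inter_mem hV (inter_mem hin hup))
  refine ⟨r, hr, fun δ hδ => ?_⟩
  obtain ⟨s, hs, hslt⟩ := exists_between (lt_min hδ hr)
  have hdist : dist (tiltedSpinningState Ω₀ s) (spinningState Ω₀) ≤ s := by
    rw [dist_pi_le_iff hs.le]
    intro i
    fin_cases i <;> simp [tiltedSpinningState, spinningState, abs_of_pos hs, hs.le]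
  refine ⟨tiltedSpinningState Ω₀ s, by simp [unitStates, tiltedSpinningState],
    hdist.trans_lt (hslt.trans_le (min_le_left _ _)), ?_⟩
  obtain ⟨x, T, hT, hx, hxr, h⟩ := exists_solvesOn_or_reaches_sphere
    (hK.mono fun ζ hζ => (hball hζ).1) (hdist.trans_lt (hslt.trans_le (min_le_right _ _)))
    (show 0 ≤ 4 * r / s by positivity)
  refine ⟨T, hT.1, x, hx, ?_⟩
  rcases h with rfl | h
  · -- a solution trapped in the ball up to this time would have tilt at least `2 * r`
    exfalso
    have hgrow := hx.mul_le_tilt hm hg hl hI₁ hI₃ hI hs hT.1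
      (fun t ht => (hball (hxr t ht)).2.1.le) (fun t ht => (hball (hxr t ht)).2.2.le)
    have h3 := (dist_le_pi_dist (x (4 * r / s)) (spinningState Ω₀) 3).trans
      (hxr _ ⟨hT.1, le_rfl⟩)
    have e3 : spinningState Ω₀ 3 = 0 := rfl
    rw [Real.dist_eq, e3, sub_zero] at h3
    have e : s / 2 * (4 * r / s) = 2 * r := by field_simp; ring
    linarith [le_abs_self (x (4 * r / s) 3)]
  · exact h.ge

end Stability

theorem mainTheorem4 (m g l I₁ I₂ I₃ Ω₀ : ℝ)
    (hm : 0 < m) (hg : 0 < g) (hl : 0 < l) (hI₁ : 0 < I₁) (hI₂ : 0 < I₂) (hI₃ : 0 < I₃)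
    (hI : I₃ < I₂) :
    skateField m g l I₁ I₂ I₃ (spinningState Ω₀) = 0 ∧
    (I₃ + m * l ^ 2 < I₂ →
      LyapunovUnstableOn (skateField m g l I₁ I₂ I₃) Set.univ (spinningState Ω₀) ∧
      LyapunovUnstableOn (skateField m g l I₁ I₂ I₃) unitStates (spinningState Ω₀)) ∧
    (I₃ + m * l ^ 2 > I₂ → |Ω₀| > Real.sqrt (m * g * l / (I₃ + m * l ^ 2 - I₂)) →
      LyapunovStableOn (skateField m g l I₁ I₂ I₃) Set.univ (spinningState Ω₀) ∧
      LyapunovStableOn (skateField m g l I₁ I₂ I₃) unitStates (spinningState Ω₀)) := by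
  refine ⟨skateField_spinningState, fun hlt => ?_, fun hgt hΩ => ?_⟩
  · have h := lyapunovUnstableOn_skateField hm hg hl hI₁ hI₃ hI hlt Ω₀
    exact ⟨h.mono (Set.subset_univ _), h⟩
  · have hsq : m * g * l / (I₃ + m * l ^ 2 - I₂) < Ω₀ ^ 2 := by
      rw [← sq_abs Ω₀]
      exact (Real.sqrt_lt' ((Real.sqrt_nonneg _).trans_lt hΩ)).1 hΩ
    rw [div_lt_iff₀ (by linarith)] at hsq
    have h := lyapunovStableOn_skateField hm hI₁ hI₃ hI hsq
    exact ⟨h, h.mono (Set.subset_univ _)⟩
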